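/- Let $\mathbb{T}=\mathbb{R}/\mathbb{Z}$ with the metric $\|x\|_{\mathbb{T}}=\inf_{p\in\mathbb{Z}}|x-p|$, let $0<t\le 1$, and let $V:\mathbb{T}\to\mathbb{C}$ be $t$-Hölder continuous with $\log|w-V(\cdot)|\in L^1(\mathbb{T})$ for every $w\in\mathbb{C}$ (in particular $V\neq w$ almost everywhere). Put $$G_1(z)=\int_{\mathbb{T}}\log|z-V(\theta)|\,d\theta .$$ Let $\alpha$ be irrational, let $q_n$ be the denominator of the $n$-th convergent of the continued fraction expansion of $\alpha$, and let $$\beta(\alpha)=\limsup_{n\to\infty}\frac{\ln q_{n+1}}{q_n}\in[0,+\infty].$$ For $\lambda>0$ and $\theta\in\mathbb{T}$ let $\widehat{H}^V_\alpha(\lambda,\theta)$ be the bounded operator on $\ell^2(\mathbb{Z})$ given by $$(\widehat{H}^V_\alpha(\lambda,\theta)u)(n)=\lambda u(n-1)+V(\theta+n\alpha)u(n),\qquad n\in\mathbb{Z}.$$ If $z$ lies in the range $R(V)=V(\mathbb{T})$ and $$t\,\beta(\alpha)>G_1(z)-\log\lambda>0,$$ then $z\in\sigma(\widehat{H}^V_\alpha(\lambda,\theta))$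 for every $\theta\in\mathbb{T}$. -/

import Mathlib

open MeasureTheory Filter
open scoped lp ENNReal NNReal

noncomputable section

namespace QuasiPeriodic

/-- The right shift `(S u)(n) = u(n - 1)` on `ℓ²(ℤ)`. -/
def shift : ℓ²(ℤ, ℂ) →L[ℂ] ℓ²(ℤ, ℂ) :=
  LinearMap.mkContinuous
    { toFun := fun u => ⟨fun n => u (n - 1), by
        have h := (memℓp_gen_iff (p := 2) (by norm_num)).1 (lp.memℓp u)
        exact (memℓp_gen_iff (by norm_num)).2 ((Equiv.subRight (1 : ℤ)).summable_iff.2 h)⟩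
      map_add' := fun _ _ => rfl
      map_smul' := fun _ _ => rfl }
    1
    (fun u => by
      rw [one_mul, lp.norm_eq_tsum_rpow (by norm_num), lp.norm_eq_tsum_rpow (by norm_num)]
      exact le_of_eq (congrArg (· ^ (1 / (2 : ℝ≥0∞).toReal))
        ((Equiv.subRight (1 : ℤ)).tsum_eq (fun n => ‖u n‖ ^ (2 : ℝ≥0∞).toReal))))

/-- Multiplication by the quasi-periodic potential `n ↦ V(θ + nα)` on `ℓ²(ℤ)`. -/
def potential (V : C(UnitAddCircle, ℂ)) (α θ : UnitAddCircle) : ℓ²(ℤ, ℂ) →L[ℂ] ℓ²(ℤ, ℂ) :=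
  lp.mapCLM 2 (fun n : ℤ => V (θ + n • α) • ContinuousLinearMap.id ℂ ℂ) (norm_nonneg V)
    (fun n => by
      rw [norm_smul, ContinuousLinearMap.norm_id, mul_one]
      exact V.norm_coe_le_norm _)

/-- The operator `(Ĥ u)(n) = lam * u(n - 1) + V(θ + nα) * u(n)` on `ℓ²(ℤ)`. -/
def dualOp (V : C(UnitAddCircle, ℂ)) (α : UnitAddCircle) (lam : ℂ) (θ : UnitAddCircle) :
    ℓ²(ℤ, ℂ) →L[ℂ] ℓ²(ℤ, ℂ) :=
  lam • shift + potential V α θ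

theorem dualOp_apply (V : C(UnitAddCircle, ℂ)) (α : UnitAddCircle) (lam : ℂ)
    (θ : UnitAddCircle) (u : ℓ²(ℤ, ℂ)) (n : ℤ) :
    dualOp V α lam θ u n = lam * u (n - 1) + V (θ + n • α) * u n :=
  rfl

/-- `log |z - V|` is in `L¹(𝕋)`. As `Real.log 0 = 0`, the requirement that `log |z - V|` be
finite almost everywhere is written out separately. -/
def LogIntegrable (V : C(UnitAddCircle, ℂ)) (z : ℂ) : Prop :=
  (∀ᵐ θ : UnitAddCircle, V θ ≠ z) ∧
    Integrable (fun θ : UnitAddCircle => Real.log ‖z - V θ‖)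

/-- `G₁(z) = ∫_𝕋 log |z - V(θ)| dθ`. -/
def G (V : C(UnitAddCircle, ℂ)) (z : ℂ) : ℝ :=
  ∫ θ : UnitAddCircle, Real.log ‖z - V θ‖

/-- The denominator `qₙ` of the `n`-th continued fraction convergent of `α`
(`q₀ = 1`, `q₁ = a₁`, `qₙ = aₙ qₙ₋₁ + qₙ₋₂`). -/
def q (α : ℝ) (n : ℕ) : ℝ :=
  (GenContFract.of α).dens n

/-- `β(α) = limsup (ln qₙ₊₁) / qₙ`, an extended real number (it may be `+∞`). -/
def beta (α : ℝ) : EReal :=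
  limsup (fun n : ℕ => ((Real.log (q α (n + 1)) / q α n : ℝ) : EReal)) atTop

end QuasiPeriodic

end

/-!
Suppose `z = V y` lies outside the spectrum, so that `z - Ĥ` is bounded below. Chaining unit
vectors over a block of `m + 1` sites starting at `j` yields a vector `u` for which `(z - Ĥ) u`
lives only at `j` and just beyond the block. If `V (θ + jα)` is close to `z`, the part at `j`
is negligible, and boundedness below forces `∏ |z - V|` over the sites `j + 1, …, j + m` to be
at most a constant times `|lam| ^ m`. The forward orbit returns to a neighbourhood of `y`
within a bounded time and is dense, so a similar bound holds along every orbit segment.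
Integrating its logarithm bounds `m * (G V z - log |lam|)` from above uniformly in `m`, hence
`G V z ≤ log |lam|`.
-/

namespace QuasiPeriodic

section LowerBidiagonal

variable {𝕜 : Type*} [NormedField 𝕜] {p : ℝ≥0∞} [Fact (1 ≤ p)]
  {T : lp (fun _ : ℤ => 𝕜) p →L[𝕜] lp (fun _ : ℤ => 𝕜) p} {a : ℤ → 𝕜} {b : 𝕜}

/-- `T` is the lower bidiagonal operator on `ℓᵖ(ℤ)` with diagonal `a` and constant subdiagonal `-b`.
The sign of `b` is chosen so that `z - Ĥ` has subdiagonal parameter `lam`. -/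
def IsLowerBidiagonal (T : lp (fun _ : ℤ => 𝕜) p →L[𝕜] lp (fun _ : ℤ => 𝕜) p) (a : ℤ → 𝕜)
    (b : 𝕜) : Prop :=
  ∀ u n, T u n = a n * u n - b * u (n - 1)

theorem IsLowerBidiagonal.map_single (hT : IsLowerBidiagonal T a b) (n : ℤ) (c : 𝕜) :
    T (lp.single p n c) = lp.single p n (a n * c) - lp.single p (n + 1) (b * c) := by
  ext k
  simp only [hT _ k, lp.coeFn_sub, Pi.sub_apply, lp.single_apply, Pi.single_apply,
    sub_eq_iff_eq_add]
  grind

theorem IsLowerBidiagonal.exists_map_eq_single_sub_single (hT : IsLowerBidiagonal T a b)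
    (j : ℤ) (m : ℕ) :
    ∃ u : lp (fun _ : ℤ => 𝕜) p, u j = ∏ i ∈ Finset.range m, a (j + 1 + i) ∧
      T u = lp.single p j (a j * u j) - lp.single p (j + 1 + m) (b ^ (m + 1)) := by
  induction m with
  | zero => exact ⟨lp.single p j 1, by simp, by simp [hT.map_single]⟩
  | succ m ih =>
    obtain ⟨u, hu, hTu⟩ := ih
    set k : ℤ := j + 1 + m
    have hjk : j ≠ k := by omega
    let v : lp (fun _ : ℤ => 𝕜) p := a k • u + lp.single p k (b ^ (m + 1))
    have hval : v j = a k * u j := by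
      rw [lp.coeFn_add, Pi.add_apply, lp.single_apply_ne p k _ hjk, add_zero, lp.coeFn_smul,
        Pi.smul_apply, smul_eq_mul]
    refine ⟨v, ?_, ?_⟩
    · rw [hval, hu, Finset.prod_range_succ, mul_comm]
    · have hk' : j + 1 + ((m + 1 : ℕ) : ℤ) = k + 1 := by push_cast; ring
      rw [map_add, map_smul, hTu, hT.map_single, hk', smul_sub, ← lp.single_smul,
        ← lp.single_smul, smul_eq_mul, smul_eq_mul, sub_add_sub_cancel, ← pow_succ', hval,
        mul_left_comm]

theorem IsLowerBidiagonal.prod_norm_le (hT : IsLowerBidiagonal T a b) {K : ℝ≥0}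
    (hK : AntilipschitzWith K T) {j : ℤ} (hj : K * ‖a j‖ ≤ 1 / 2) (m : ℕ) :
    ∏ i ∈ Finset.range m, ‖a (j + 1 + i)‖ ≤ 2 * K * ‖b‖ ^ (m + 1) := by
  have hp : 0 < p := zero_lt_one.trans_le Fact.out
  obtain ⟨u, hu, hTu⟩ := hT.exists_map_eq_single_sub_single j m
  rw [← norm_prod, ← hu]
  have hmap : ‖T u‖ ≤ ‖a j‖ * ‖u j‖ + ‖b‖ ^ (m + 1) := by
    rw [hTu]
    refine (norm_sub_le _ _).trans_eq ?_
    rw [lp.norm_single hp, lp.norm_single hp, norm_mul, norm_pow]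
  have hself : ‖u j‖ ≤ 1 / 2 * ‖u j‖ + K * ‖b‖ ^ (m + 1) := calc
    ‖u j‖ ≤ ‖u‖ := lp.norm_apply_le_norm hp.ne' u j
    _ ≤ K * ‖T u‖ := ZeroHomClass.bound_of_antilipschitz T hK u
    _ ≤ K * (‖a j‖ * ‖u j‖ + ‖b‖ ^ (m + 1)) := by gcongr
    _ = K * ‖a j‖ * ‖u j‖ + K * ‖b‖ ^ (m + 1) := by ring
    _ ≤ 1 / 2 * ‖u j‖ + K * ‖b‖ ^ (m + 1) := by gcongr
  linarith

end LowerBidiagonal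

theorem isLowerBidiagonal_sub_dualOp (V : C(UnitAddCircle, ℂ)) (α : UnitAddCircle) (lam : ℂ)
    (θ : UnitAddCircle) (z : ℂ) :
    IsLowerBidiagonal (algebraMap ℂ (ℓ²(ℤ, ℂ) →L[ℂ] ℓ²(ℤ, ℂ)) z - dualOp V α lam θ)
      (fun n => z - V (θ + n • α)) lam := by
  intro u n
  change z * u n - dualOp V α lam θ u n = _
  rw [dualOp_apply]
  ring

theorem exists_antilipschitzWith_sub_of_notMem_spectrum {𝕜 E : Type*}
    [NontriviallyNormedField 𝕜] [NormedAddCommGroup E] [NormedSpace 𝕜 E] {T : E →L[𝕜] E} {z : 𝕜}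
    (hz : z ∉ spectrum 𝕜 T) :
    ∃ K, AntilipschitzWith K (algebraMap 𝕜 (E →L[𝕜] E) z - T) := by
  obtain ⟨S, hS⟩ := spectrum.notMem_iff.1 hz
  rw [← hS]
  exact ⟨_, (ContinuousLinearEquiv.ofUnit S).antilipschitz⟩

theorem prod_range_le_of_forall_prod_tail_le {a : ℕ → ℝ} {A D : ℝ} {L j : ℕ}
    (ha : ∀ i, 0 ≤ a i) (haA : ∀ i, a i ≤ A) (hA : 1 ≤ A) (hj : j ≤ L)
    (hD : ∀ r, ∏ i ∈ Finset.range r, a (j + i) ≤ D) (m : ℕ) :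
    ∏ i ∈ Finset.range m, a i ≤ A ^ L * max 1 D := by
  have hpow : ∀ k ≤ L, ∏ i ∈ Finset.range k, a i ≤ A ^ L := fun k hk => calc
    ∏ i ∈ Finset.range k, a i ≤ ∏ _i ∈ Finset.range k, A :=
      Finset.prod_le_prod (fun i _ => ha i) fun i _ => haA i
    _ = A ^ k := by simp
    _ ≤ A ^ L := pow_le_pow_right₀ hA hk
  rcases le_total m j with hm | hm
  · exact (hpow m (hm.trans hj)).trans
      (le_mul_of_one_le_right (by positivity) (le_max_left _ _))
  · obtain ⟨r, rfl⟩ := Nat.exists_eq_add_of_le hm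
    rw [Finset.prod_range_add]
    exact mul_le_mul (hpow j hj) ((hD r).trans (le_max_right _ _))
      (Finset.prod_nonneg fun i _ => ha _) (by positivity)

section Rotation

variable {X : Type*} [AddGroup X] [TopologicalSpace X] [ContinuousAdd X]
  [CompactSpace X] {α : X}

theorem exists_forall_exists_le_add_nsmul_mem
    (hα : DenseRange fun n : ℕ => n • α) {U : Set X} (hU : IsOpen U) (hne : U.Nonempty) :
    ∃ L : ℕ, ∀ x : X, ∃ j ≤ L, x + j • α ∈ U := by
  have hcover : ∀ x : X, ∃ j : ℕ, x + j • α ∈ U := fun x =>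
    hα.exists_mem_open (hU.preimage (continuous_const_add x))
      (hne.preimage (Homeomorph.addLeft x).surjective)
  obtain ⟨s, hs⟩ := isCompact_univ.elim_finite_subcover (fun j : ℕ => {x | x + j • α ∈ U})
    (fun j => hU.preimage (continuous_add_const _)) (fun x _ => Set.mem_iUnion.2 (hcover x))
  refine ⟨s.sup id, fun x => ?_⟩
  obtain ⟨j, hj, hx⟩ := Set.mem_iUnion₂.1 (hs (Set.mem_univ x))
  exact ⟨j, Finset.le_sup (f := id) hj, hx⟩

theorem exists_forall_prod_add_nsmul_le
    (hα : DenseRange fun n : ℕ => n • α) {f : X → ℝ} (hf : Continuous f) (hf0 : ∀ x, 0 ≤ f x)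
    {U : Set X} (hU : IsOpen U) (hne : U.Nonempty) {θ : X} {D : ℝ}
    (hD : ∀ n : ℕ, θ + n • α ∈ U →
      ∀ m : ℕ, ∏ i ∈ Finset.range m, f (θ + (n + 1 + i) • α) ≤ D) :
    ∃ M : ℝ, ∀ (x : X) (m : ℕ), ∏ i ∈ Finset.range m, f (x + i • α) ≤ M := by
  obtain ⟨L, hL⟩ := exists_forall_exists_le_add_nsmul_mem hα hU hne
  obtain ⟨A, hA⟩ := (isCompact_range hf).bddAbove
  have horbit : ∀ n m : ℕ, ∏ i ∈ Finset.range m, f (θ + n • α + i • α) ≤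
      max 1 A ^ (L + 1) * max 1 D := by
    intro n m
    obtain ⟨j, hj, hjU⟩ := hL (θ + n • α)
    refine prod_range_le_of_forall_prod_tail_le (fun i => hf0 _)
      (fun i => (hA ⟨_, rfl⟩).trans (le_max_right _ _)) (le_max_left _ _)
      (show j + 1 ≤ L + 1 by gcongr) (fun r => ?_) m
    have hret := hD (n + j) (by rwa [add_nsmul, ← add_assoc]) r
    simpa only [add_assoc, ← add_nsmul] using hret
  have hθ : DenseRange fun n : ℕ => θ + n • α :=
    (Homeomorph.addLeft θ).surjective.denseRange.comp hα (continuous_const_add θ)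
  exact ⟨_, fun x m => hθ.induction_on x
    (isClosed_le (by fun_prop) continuous_const) fun n => horbit n m⟩

end Rotation

section Birkhoff

variable {X : Type*} [MeasurableSpace X] {μ : Measure X} {T : X → X}

theorem integrable_birkhoffSum {E : Type*} [NormedAddCommGroup E] (hT : MeasurePreserving T μ μ)
    {g : X → E} (hg : Integrable g μ) (n : ℕ) : Integrable (birkhoffSum T g n) μ :=
  integrable_finsetSum _ fun k _ => (hT.iterate k).integrable_comp_of_integrable hg

theorem integral_birkhoffSum {E : Type*} [NormedAddCommGroup E] [NormedSpace ℝ E]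
    (hT : MeasurePreserving T μ μ) {g : X → E} (hg : Integrable g μ) (n : ℕ) :
    ∫ x, birkhoffSum T g n x ∂μ = n • ∫ x, g x ∂μ := by
  have hiterate : ∀ k, ∫ x, g (T^[k] x) ∂μ = ∫ x, g x ∂μ := fun k => by
    have hmap := (hT.iterate k).map_eq
    rw [← integral_map (hT.iterate k).aemeasurable (by rw [hmap]; exact hg.1), hmap]
  calc ∫ x, birkhoffSum T g n x ∂μ = ∑ k ∈ Finset.range n, ∫ x, g (T^[k] x) ∂μ :=
        integral_finsetSum _ fun k _ => (hT.iterate k).integrable_comp_of_integrable hg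
    _ = n • ∫ x, g x ∂μ := by simp only [hiterate, Finset.sum_const, Finset.card_range]

theorem integral_nonpos_of_birkhoffSum_le [IsFiniteMeasure μ] (hT : MeasurePreserving T μ μ)
    {g : X → ℝ} (hg : Integrable g μ) {M : ℝ} (hM : ∀ n, ∀ᵐ x ∂μ, birkhoffSum T g n x ≤ M) :
    ∫ x, g x ∂μ ≤ 0 := by
  have hbound : ∀ n : ℕ, n • ∫ x, g x ∂μ ≤ ∫ _, M ∂μ := fun n => by
    rw [← integral_birkhoffSum hT hg]
    exact integral_mono_ae (integrable_birkhoffSum hT hg n) (integrable_const M) (hM n)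
  by_contra! hpos
  obtain ⟨n, hn⟩ := Archimedean.arch (∫ _, M ∂μ + 1) hpos
  linarith [hbound n]

theorem integral_log_nonpos_of_prod_iterate_le [IsFiniteMeasure μ] (hT : MeasurePreserving T μ μ)
    {f : X → ℝ} (hf0 : ∀ᵐ x ∂μ, 0 < f x) (hf : Integrable (fun x => Real.log (f x)) μ) {M : ℝ}
    (hM : ∀ n, ∀ᵐ x ∂μ, ∏ k ∈ Finset.range n, f (T^[k] x) ≤ M) :
    ∫ x, Real.log (f x) ∂μ ≤ 0 := by
  refine integral_nonpos_of_birkhoffSum_le hT hf (M := Real.log M) fun n => ?_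
  have hpos : ∀ᵐ x ∂μ, ∀ k, 0 < f (T^[k] x) :=
    ae_all_iff.2 fun k => (hT.iterate k).quasiMeasurePreserving.ae hf0
  filter_upwards [hpos, hM n] with x hx hxM
  rw [birkhoffSum, ← Real.log_prod fun k _ => (hx k).ne']
  exact Real.log_le_log (Finset.prod_pos fun k _ => hx k) hxM

end Birkhoff

theorem exists_forall_prod_le_of_notMem_spectrum {V : C(UnitAddCircle, ℂ)} {α θ : UnitAddCircle}
    (hα : DenseRange fun n : ℕ => n • α) {lam z : ℂ} (hlam : lam ≠ 0) (hz : z ∈ Set.range V)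
    (h : z ∉ spectrum ℂ (dualOp V α lam θ)) :
    ∃ M : ℝ, ∀ (x : UnitAddCircle) (m : ℕ),
      ∏ i ∈ Finset.range m, ‖z - V (x + i • α)‖ / ‖lam‖ ≤ M := by
  obtain ⟨K, hK⟩ := exists_antilipschitzWith_sub_of_notMem_spectrum h
  obtain ⟨y, rfl⟩ := hz
  refine exists_forall_prod_add_nsmul_le (f := fun x => ‖V y - V x‖ / ‖lam‖) hα (by fun_prop)
    (fun x => by positivity) (U := {x | K * ‖V y - V x‖ < 1 / 2}) (θ := θ) (D := 2 * K * ‖lam‖)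
    (isOpen_lt (by fun_prop) continuous_const) ⟨y, by simp⟩ fun n hn m => ?_
  have hprod := (isLowerBidiagonal_sub_dualOp V α lam θ (V y)).prod_norm_le hK
    (j := n) (by simpa only [natCast_zsmul] using hn.out.le) m
  rw [Finset.prod_div_distrib, Finset.prod_const, Finset.card_range,
    div_le_iff₀ (by positivity), mul_assoc, ← pow_succ']
  exact_mod_cast hprod

theorem LogIntegrable.G_le_log_of_forall_prod_le {V : C(UnitAddCircle, ℂ)} {z lam : ℂ}
    (hlog : LogIntegrable V z) (hlam : lam ≠ 0) {α : UnitAddCircle} {M : ℝ}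
    (hM : ∀ (x : UnitAddCircle) (m : ℕ),
      ∏ i ∈ Finset.range m, ‖z - V (x + i • α)‖ / ‖lam‖ ≤ M) :
    G V z ≤ Real.log ‖lam‖ := by
  have hpos : ∀ᵐ x : UnitAddCircle, 0 < ‖z - V x‖ :=
    hlog.1.mono fun x hx => norm_pos_iff.2 (sub_ne_zero.2 hx.symm)
  have hlogdiv : (fun x : UnitAddCircle => Real.log (‖z - V x‖ / ‖lam‖)) =ᵐ[volume]
      fun x => Real.log ‖z - V x‖ - Real.log ‖lam‖ :=
    hpos.mono fun x hx => Real.log_div hx.ne' (norm_ne_zero_iff.2 hlam)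
  have hle := integral_log_nonpos_of_prod_iterate_le
    (measurePreserving_add_right (volume : Measure UnitAddCircle) α)
    (hpos.mono fun x hx => div_pos hx (norm_pos_iff.2 hlam))
    ((integrable_congr hlogdiv).2 (hlog.2.sub (integrable_const _)))
    fun m => ae_of_all _ fun x => by simpa only [add_right_iterate] using hM x m
  rw [integral_congr_ae hlogdiv, integral_sub hlog.2 (integrable_const _)] at hle
  simpa [G, measureReal_def] using hle

end QuasiPeriodic

theorem proposition3p6_general (V : C(UnitAddCircle, ℂ)) {z : ℂ}
    (hlog : QuasiPeriodic.LogIntegrable V z) {α : ℝ} (hα : Irrational α) {lam : ℂ}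
    (hlam : lam ≠ 0) (hz : z ∈ Set.range V) (hpos : Real.log ‖lam‖ < QuasiPeriodic.G V z)
    (θ : UnitAddCircle) :
    z ∈ spectrum ℂ (QuasiPeriodic.dualOp V (α : UnitAddCircle) lam θ) := by
  by_contra h
  have hdense : DenseRange fun n : ℕ => n • (α : UnitAddCircle) :=
    denseRange_zsmul_iff_nsmul.1 (AddCircle.denseRange_zsmul_coe_iff.2 (by simpa using hα))
  obtain ⟨M, hM⟩ := QuasiPeriodic.exists_forall_prod_le_of_notMem_spectrum hdense hlam hz h
  exact (hlog.G_le_log_of_forall_prod_le hlam hM).not_gt hpos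

theorem proposition3p6
    (V : C(UnitAddCircle, ℂ)) (hlog : ∀ w : ℂ, QuasiPeriodic.LogIntegrable V w)
    (C t : ℝ≥0) (ht0 : 0 < t) (ht1 : t ≤ 1) (hV : HolderWith C t V)
    (α : ℝ) (hα : Irrational α) (lam : ℝ) (hlam : 0 < lam)
    (z : ℂ) (hz : z ∈ Set.range V)
    (hpos : 0 < QuasiPeriodic.G V z - Real.log lam)
    (hβ : ((QuasiPeriodic.G V z - Real.log lam : ℝ) : EReal) <
      ((t : ℝ) : EReal) * QuasiPeriodic.beta α)
    (θ : UnitAddCircle) :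
    z ∈ spectrum ℂ (QuasiPeriodic.dualOp V (α : UnitAddCircle) (lam : ℂ) θ) := by
  exact proposition3p6_general V (hlog z) hα (by exact_mod_cast hlam.ne') hz
    (by simpa using hpos) θ
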